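/- **Setting.** Let $O$ be a regular octagon with two horizontal sides, opposite sides being identified by translations. Label the pairs of opposite sides by $\mathscr A=\{A,B,C,D\}$: $A$ for the top and bottom sides, $B$ for the upper right and lower left, $C$ for the right and left, $D$ for the lower right and upper left. A (bi-infinite) linear trajectory moves in $O$ with constant nonzero velocity, never hits a vertex, and on hitting a side continues from the corresponding point of the opposite side. Its cutting sequence $c(\tau)\in\mathscr A^{\mathbb Z}$ lists the labels of the sides it crosses as time increases; $\tau$ realizes a finite word $u$ if $u$ is the sequence of labels crossed by some finite piece of $\tau$. The space $\mathscr A^{\mathbb Z}$ carries the product topology, and derived and generated words below are taken up to the choice of the letter with index $0$. *Admissibility.* Let $\pi_0,\dots,\pi_7$ be the permutations $\mathrm{id}$, $(AD)(BC)$, $(ABCD)$, $(AC)$, $(AC)(BD)$, $(AB)(CD)$, $(ADCB)$, $(BD)$, acting on words letter by letter. The diagram $\mathscr D_0$ has the edges $A\rightleftarrows D\rightleftarrows B\rightleftarrows C$ and a loop at $C$; $L\to L'$ is an edge of $\mathscr D_i$ if $\pi_iL\to\pi_iL'$ is an edge of $\mathscr D_0$. A word is admissible in diagram $i$ if all its pairs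 of successive letters are edges of $\mathscr D_i$, and admissible if it is so for some $i\in\{0,\dots,7\}$. *Derivation.* A letter of a word is $L'$-sandwiched if it is preceded and followed by $L'$. The derived sequence $w'$ consists of the sandwiched letters of $w$, in order. A word $w$ is derivable if $w$ and $w'$ are admissible, and infinitely derivable if $w$ and all its iterated derived sequences are derivable. *Coherence.* Let $G_0,\dots,G_3$ be the following groups of sandwiched letters. In every group $A$ is $D$-sandwiched; $B$ is $C$-sandwiched in $G_0,G_1,G_2$ and $D$-sandwiched in $G_3$; $C$ is $B$-sandwiched in $G_0,G_1$ and $C$-sandwiched in $G_2,G_3$; $D$ is $A$-sandwiched in $G_0$ and $B$-sandwiched in $G_1,G_2,G_3$. A derivable word $w$ is coherent with respect to $(i,j)$, $0\le i,j\le 7$, if $w$ is admissible in diagram $i$, $j\ne0$, $(\pi_i\cdot w)'$ is admissible in diagram $j$, and all sandwiched letters of $\pi_i\cdot w$ are sandwiched as in $G_{\lfloor j/2\rfloor}$. Let $S^*$ be the set of sequences $s=(s_k)_{k\ge0}$ in $\{0,\dots,7\}$ with $s_k\neq0$ for $k\ge1$. A word $w$ is infinitely coherent with respect to $s\in S^*$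 if it is infinitely derivable and, for every $k\ge 0$, the word $w_k$ is coherent with respect to $(s_k,s_{k+1})$, where $w_0=w$ and $w_{k+1}=(\pi_{s_k}\cdot w_k)'$. It is infinitely coherent if it is so with respect to some $s\in S^*$. *Generation.* For $1\le k\le7$, $g=\lfloor k/2\rfloor$ and an edge $L_1\to L_2$ of $\mathscr D_k$, the interpolating word $w^k_{L_1L_2}$ is given as follows ($\varnothing$ is the empty word; at pairs that are not edges of $\mathscr D_k$ the value is not used). - $AA$: $DBCCBD$; $BB$: $CC$; $CC$: $\varnothing$; $DD$: $BCCB$. - If $g\le 2$: $AB$: $DBCC$; $BA$: $CCBD$; $BD$: $CCB$; $DB$: $BCC$. If $g=3$: $AB$: $D$; $BA$: $D$; $BD$: $\varnothing$; $DB$: $\varnothing$. - If $g\le1$: $AC$: $DB$; $CA$: $BD$; $BC$: $\varnothing$; $CB$: $\varnothing$; $CD$: $B$; $DC$: $B$. If $g\ge2$: $AC$: $DBC$; $CA$: $CBD$; $BC$: $C$; $CB$: $C$; $CD$: $CB$; $DC$: $BC$. - If $g=0$: $AD$: $\varnothing$; $DA$: $\varnothing$. If $g\geq1$: $AD$: $DBCCB$;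 $DA$: $BCCBD$. For $v$ admissible in diagram $j\ne0$, let $\mathfrak g_j^0v$ be the word obtained from $v$ by inserting $w^j_{L_1L_2}$ between each two successive letters $L_1L_2$, and $\mathfrak g_j^iv=\pi_i^{-1}\cdot\mathfrak g_j^0v$. For $s\in S^*$ and $k\geq 0$ let $\mathscr P(s_0,\dots,s_k)$ be the set of all words $\mathfrak g_{s_1}^{s_0}\mathfrak g_{s_2}^{s_1}\cdots\mathfrak g_{s_k}^{s_{k-1}}u$, where $u$ is a periodic word of period $1$ or $2$ that is admissible in diagram $s_k$. **Statement.** Let $w\in\mathscr A^{\mathbb Z}$. 1. If $w$ is infinitely coherent, then every finite subword of $w$ is realized by a periodic linear trajectory. 2. If $w$ is infinitely coherent with respect to $s\in S^*$, then every finite subword of $w$ occurs in some word of $\bigcup_{k\ge0}\mathscr P(s_0,\dots,s_k)$ that is the cutting sequence of a periodic linear trajectory. Moreover $w$ lies in the closure of the set of those words of $\bigcup_{k\ge0}\mathscr P(s_0,\dots,s_k)$ that are cutting sequences of periodic linear trajectories; in particular $w\in\overline{\bigcup_{k\ge0}\mathscr P(s_0,\dots,s_k)}$. -/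

import Mathlib

namespace Octagon

/-! ### Words -/

/-- The labels of the four pairs of opposite sides. -/
inductive Letter where
  | A | B | C | D
  deriving DecidableEq

instance : TopologicalSpace Letter := ⊥

instance : DiscreteTopology Letter := ⟨rfl⟩

/-- Bi-infinite words, with the product topology of the discrete alphabet. -/
abbrev Word : Type := ℤ → Letter

/-- The finite word `u` occurs in the bi-infinite word `w`. -/
def IsSubword (u : List Letter) (w : Word) : Prop :=
  ∃ m : ℤ, ∀ i : Fin u.length, w (m + (i : ℕ)) = u.get i

open Letter Equiv in
/-- The relabelling `π_i` induced by the isometry of the octagon that carries the sector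
`[iπ/8, (i+1)π/8]` to `[0, π/8]`:
`id, (AD)(BC), (ABCD), (AC), (AC)(BD), (AB)(CD), (ADCB), (BD)`. -/
def sectorPerm : Fin 8 → Equiv.Perm Letter :=
  ![1,
    swap A D * swap B C,
    swap A B * swap B C * swap C D,
    swap A C,
    swap A C * swap B D,
    swap A B * swap C D,
    swap A D * swap D C * swap C B,
    swap B D]

/-- The action of a permutation of the letters on words. -/
def permute (π : Equiv.Perm Letter) (w : Word) : Word := fun n => π (w n)

/-- The edges of the transition diagram `𝒟₀`: `A ⇄ D ⇄ B ⇄ C` and a loop at `C`. -/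
def EdgeZero (L L' : Letter) : Prop :=
  (L, L') ∈ ([(.A, .D), (.D, .A), (.D, .B), (.B, .D), (.B, .C), (.C, .B), (.C, .C)] :
    List (Letter × Letter))

/-- The edges of the transition diagram `𝒟_i`, which `π_i` carries to `𝒟₀`. -/
def Edge (i : Fin 8) (L L' : Letter) : Prop :=
  EdgeZero (sectorPerm i L) (sectorPerm i L')

/-- `w` is admissible in diagram `i`. -/
def AdmissibleIn (i : Fin 8) (w : Word) : Prop :=
  ∀ n : ℤ, Edge i (w n) (w (n + 1))

/-- `w` is admissible. -/
def Admissible (w : Word) : Prop := ∃ i : Fin 8, AdmissibleIn i w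

/-! ### Derivation -/

/-- The letter of `w` at place `n` is sandwiched, by the letter `w (n - 1) = w (n + 1)`. -/
def SandwichedAt (w : Word) (n : ℤ) : Prop := w (n - 1) = w (n + 1)

/-- `v` is the derived sequence of `w`: the sandwiched letters of `w`, listed in order.  The
choice of the letter of `v` that has index `0` is left free. -/
def IsDerived (w v : Word) : Prop :=
  ∃ e : ℤ → ℤ, StrictMono e ∧ Set.range e = {n | SandwichedAt w n} ∧ ∀ n, v n = w (e n)

/-- `w` and its derived sequence are admissible. -/
def Derivable (w : Word) : Prop :=
  Admissible w ∧ ∃ v, IsDerived w v ∧ Admissible v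

/-- `w` and all its iterated derived sequences are derivable. -/
def InfinitelyDerivable (w : Word) : Prop :=
  ∃ V : ℕ → Word, V 0 = w ∧ ∀ n, Derivable (V n) ∧ IsDerived (V n) (V (n + 1))

/-! ### Coherence -/

/-- The four groups `G₀, G₁, G₂, G₃`: in the group `G_k`, the letter `L` is
`sandwichGroup k L`-sandwiched. -/
def sandwichGroup (k : Fin 4) : Letter → Letter
  | .A => .D
  | .B => if k ≤ 2 then .C else .D
  | .C => if k ≤ 1 then .B else .C
  | .D => if k = 0 then .A else .B

/-- `w` is coherent with respect to the pair `(i, j)`. -/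
def CoherentWith (w : Word) (i j : Fin 8) : Prop :=
  Derivable w ∧
  AdmissibleIn i w ∧
  (∃ v, IsDerived (permute (sectorPerm i) w) v ∧ AdmissibleIn j v) ∧ j ≠ 0 ∧
  ∃ k : Fin 4, (k : ℕ) = (j : ℕ) / 2 ∧
    ∀ n, SandwichedAt (permute (sectorPerm i) w) n →
      permute (sectorPerm i) w (n - 1) = sandwichGroup k (permute (sectorPerm i) w n)

/-- The set `S*` of sequences in `{0, …, 7}` whose entries after the first one are nonzero. -/
def SStar : Set (ℕ → Fin 8) := {s | ∀ k, s k = 0 → k = 0}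

/-- `W` is the sequence of renormalized words `w₀ = w`, `w_{k+1} = (π_{s_k} · w_k)'`. -/
def IsRenormalization (w : Word) (s : ℕ → Fin 8) (W : ℕ → Word) : Prop :=
  W 0 = w ∧ ∀ k, IsDerived (permute (sectorPerm (s k)) (W k)) (W (k + 1))

/-- `w` is infinitely coherent with respect to `s`. -/
def InfinitelyCoherentWith (w : Word) (s : ℕ → Fin 8) : Prop :=
  s ∈ SStar ∧ InfinitelyDerivable w ∧
    ∃ W, IsRenormalization w s W ∧ ∀ k, CoherentWith (W k) (s k) (s (k + 1))

/-- `w` is infinitely coherent. -/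
def InfinitelyCoherent (w : Word) : Prop := ∃ s, InfinitelyCoherentWith w s

/-! ### Generation -/

/-- The interpolating word on the edge from `L` to `L'` of the diagram `𝒟_k`, `1 ≤ k ≤ 7`; it
depends on `k` through the integer part of `k / 2` only.  The values at pairs that are not edges
of `𝒟_k` are never used. -/
def interpolation (k : Fin 8) : Letter → Letter → List Letter
  | .A, .A => [.D, .B, .C, .C, .B, .D]
  | .A, .B => if (k : ℕ) / 2 ≤ 2 then [.D, .B, .C, .C] else [.D]
  | .A, .C => if (k : ℕ) / 2 ≤ 1 then [.D, .B] else [.D, .B, .C]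
  | .A, .D => if (k : ℕ) / 2 = 0 then [] else [.D, .B, .C, .C, .B]
  | .B, .A => if (k : ℕ) / 2 ≤ 2 then [.C, .C, .B, .D] else [.D]
  | .B, .B => [.C, .C]
  | .B, .C => if (k : ℕ) / 2 ≤ 1 then [] else [.C]
  | .B, .D => if (k : ℕ) / 2 ≤ 2 then [.C, .C, .B] else []
  | .C, .A => if (k : ℕ) / 2 ≤ 1 then [.B, .D] else [.C, .B, .D]
  | .C, .B => if (k : ℕ) / 2 ≤ 1 then [] else [.C]
  | .C, .C => []
  | .C, .D => if (k : ℕ) / 2 ≤ 1 then [.B] else [.C, .B]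
  | .D, .A => if (k : ℕ) / 2 = 0 then [] else [.B, .C, .C, .B, .D]
  | .D, .B => if (k : ℕ) / 2 ≤ 2 then [.B, .C, .C] else []
  | .D, .C => if (k : ℕ) / 2 ≤ 1 then [.B] else [.B, .C]
  | .D, .D => [.B, .C, .C, .B]

/-- `W` is the word obtained from the word `v`, admissible in diagram `k`, by inserting between
successive letters the interpolating words of diagram `k`.  Here `e n` is the place in `W` of the
`n`-th letter of `v`; the place of the letter with index `0` is left free. -/
def IsGeneratedZero (k : Fin 8) (v W : Word) : Prop :=
  AdmissibleIn k v ∧ ∃ e : ℤ → ℤ, ∀ n : ℤ,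
    W (e n) = v n ∧
    e (n + 1) = e n + 1 + ((interpolation k (v n) (v (n + 1))).length : ℤ) ∧
    ∀ i : Fin (interpolation k (v n) (v (n + 1))).length,
      W (e n + 1 + (i : ℕ)) = (interpolation k (v n) (v (n + 1))).get i

/-- `W` is the image of `v` under the generation operator from diagram `j` to diagram `i`, that
is, under generation in diagram `j` followed by `π_i⁻¹`. -/
def IsGenerated (j i : Fin 8) (v W : Word) : Prop :=
  ∃ W₀, IsGeneratedZero j v W₀ ∧ W = permute (sectorPerm i)⁻¹ W₀

/-- The words of period one or two that are admissible in diagram `k`. -/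
def shortPeriodic (k : Fin 8) : Set Word :=
  {u | AdmissibleIn k u ∧ ∀ n, u (n + 2) = u n}

/-- The set `𝒫(s₀, …, s_k)` of the words that are obtained from the words of period one or two
admissible in diagram `s_k` by applying successively the generation operators from diagram `s_k`
to `s_{k-1}`, …, from diagram `s₁` to `s₀`. -/
def generatedPeriodic : ℕ → (ℕ → Fin 8) → Set Word
  | 0, s => shortPeriodic (s 0)
  | k + 1, s => {w | ∃ v ∈ generatedPeriodic k (fun n => s (n + 1)), IsGenerated (s 1) (s 0) v w}

/-! ### Linear trajectories in the octagon -/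

/-- The outward unit normal of the `k`-th side, counted counterclockwise from the right side. -/
noncomputable def normal (k : Fin 8) : ℝ × ℝ :=
  (Real.cos ((k : ℕ) * (Real.pi / 4)), Real.sin ((k : ℕ) * (Real.pi / 4)))

/-- The Euclidean inner product of `p` with the `k`-th outward unit normal. -/
noncomputable def height (k : Fin 8) (p : ℝ × ℝ) : ℝ :=
  (normal k).1 * p.1 + (normal k).2 * p.2

/-- The interior of the regular octagon centred at the origin, with two horizontal sides and with
inradius `1`. -/
def octagonInterior : Set (ℝ × ℝ) := {p | ∀ k, height k p < 1}

/-- The `k`-th side of the octagon, without its end points. -/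
def openSide (k : Fin 8) : Set (ℝ × ℝ) := {p | height k p = 1 ∧ ∀ l, l ≠ k → height l p < 1}

/-- The label of the `k`-th side.  Opposite sides have the same label: `C` is the right and the
left side, `B` the upper right and the lower left one, `A` the top and the bottom one, and `D` the
upper left and the lower right one. -/
def sideLabel : Fin 8 → Letter := ![.C, .B, .A, .D, .C, .B, .A, .D]

/-- A bi-infinite linear trajectory in the octagon with opposite sides identified by translations.
The point `pos t` of the octagon moves with constant velocity; at the times `time n` it hits the
side `side n` away from the vertices and continues from the corresponding point on the opposite
side, which is the translate by `-2 • normal (side n)`. -/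
structure LinearTrajectory where
  pos : ℝ → ℝ × ℝ
  vel : ℝ × ℝ
  vel_ne_zero : vel ≠ 0
  time : ℤ → ℝ
  side : ℤ → Fin 8
  time_strictMono : StrictMono time
  time_tendsto_atTop : Filter.Tendsto time Filter.atTop Filter.atTop
  time_tendsto_atBot : Filter.Tendsto time Filter.atBot Filter.atBot
  pos_time : ∀ n, pos (time n) ∈ openSide (side n)
  pos_mem_interior : ∀ n t, time n < t → t < time (n + 1) → pos t ∈ octagonInterior
  pos_eq : ∀ n t, time n < t → t ≤ time (n + 1) →
    pos t = pos (time n) - (2 : ℝ) • normal (side n) + (t - time n) • vel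

/-- The cutting sequence `c(τ)`. -/
def LinearTrajectory.cuttingSequence (τ : LinearTrajectory) : Word :=
  fun n => sideLabel (τ.side n)

/-- `τ` is a periodic trajectory. -/
def LinearTrajectory.IsPeriodic (τ : LinearTrajectory) : Prop :=
  ∃ T : ℝ, 0 < T ∧ ∀ t, τ.pos (t + T) = τ.pos t

/-- `τ` realizes the finite word `u`: the labels of the sides that some finite piece of `τ`
crosses form `u`. -/
def LinearTrajectory.Realizes (τ : LinearTrajectory) (u : List Letter) : Prop :=
  ∃ a b : ℝ, a < b ∧ ∃ m : ℤ,
    (∀ n : ℤ, τ.time n ∈ Set.Ioo a b ↔ m ≤ n ∧ n < m + (u.length : ℤ)) ∧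
    ∀ i : Fin u.length, sideLabel (τ.side (m + (i : ℕ))) = u.get i

/-- The cutting sequences of periodic trajectories. -/
def periodicCuttingSequences : Set Word :=
  {v | ∃ τ : LinearTrajectory, τ.IsPeriodic ∧ τ.cuttingSequence = v}

end Octagon

namespace Octagon

/-! ### Sequences indexed by the integers -/

/-! A window of `w` is treated by strong induction on its length (`exists_generatedPeriodic`). If
every letter strictly inside it is sandwiched, the window alternates between two letters and agrees
with a word of period one or two. Otherwise coherence makes π_{s₀}·w the interpolation of w₁
(`interpolates_of_sandwiched`). As some inner letter is not sandwiched, the window is covered by the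
interpolation of a strictly shorter window of w₁ (`exists_shorter_window`). The induction hypothesis
replaces w₁ there by a generated periodic word, and interpolation is local (`Interpolates.eq_on`).

That the resulting word is a cutting sequence is ensured by a certificate carried through the
induction: `PeriodicOrbit`, a direction in [0, π/8] with a periodic list of crossing points on the
sides, in transversal coordinates. Alternating words have one, the orbit through the midpoints of
two sides. Generation preserves it: an affine automorphism of the octagon surface turns a segment
between two sides into a path across the sides named by the interpolating word, which comes down to
finitely many linear inequalities (`isChain_crossings`). A certificate yields a trajectory
(`PeriodicOrbit.mem_periodicCuttingSequences`), and the symmetries of the octagon take care of the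
other sectors. -/

theorem exists_last_int {P : ℤ → Prop} (hne : ∃ n, P n) (hbd : ∃ b, ∀ n, P n → n ≤ b) :
    ∃ n, P n ∧ ¬ P (n + 1) := by
  obtain ⟨n, hn, hmax⟩ := Int.exists_greatest_of_bdd hbd hne
  exact ⟨n, hn, fun h => by have := hmax _ h; omega⟩

/-- Every integer sequence of increments has a sum with a prescribed value. -/
theorem exists_int_sum {G : Type*} [AddCommGroup G] (f : ℤ → G) (n₀ : ℤ) (g₀ : G) :
    ∃ F : ℤ → G, F n₀ = g₀ ∧ ∀ n, F (n + 1) = F n + f n := by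
  refine ⟨fun n => g₀ + ∑ k ∈ Finset.Ico n₀ n, f k - ∑ k ∈ Finset.Ico n n₀, f k, by simp, ?_⟩
  intro n
  rcases le_or_gt n₀ n with h | h
  · have h1 : Finset.Ico n₀ (n + 1) = insert n (Finset.Ico n₀ n) := by
      ext k; simp only [Finset.mem_Ico, Finset.mem_insert]; omega
    have h2 : Finset.Ico (n + 1) n₀ = ∅ := Finset.Ico_eq_empty_of_le (by omega)
    have h3 : Finset.Ico n n₀ = ∅ := Finset.Ico_eq_empty_of_le (by omega)
    simp only [h1, h2, h3, Finset.sum_empty]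
    rw [Finset.sum_insert (by simp)]
    abel
  · have h1 : Finset.Ico n n₀ = insert n (Finset.Ico (n + 1) n₀) := by
      ext k; simp only [Finset.mem_Ico, Finset.mem_insert]; omega
    have h2 : Finset.Ico n₀ n = ∅ := Finset.Ico_eq_empty_of_le (by omega)
    have h3 : Finset.Ico n₀ (n + 1) = ∅ := Finset.Ico_eq_empty_of_le (by omega)
    simp only [h1, h2, h3, Finset.sum_empty]
    rw [Finset.sum_insert (by simp)]
    abel

/-- Strictly increasing integer sequences have slope at least one; hence they are unbounded in both
directions and cut ℤ into blocks. -/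
theorem sub_le_sub_of_strictMono {e : ℤ → ℤ} (he : StrictMono e) {m n : ℤ} (h : m ≤ n) :
    n - m ≤ e n - e m := by
  have : Monotone fun n => e n - n := monotone_int_of_le_succ fun k => by
    have := he (show k < k + 1 by omega)
    omega
  have := this h
  simp only at this
  omega

theorem exists_block {e : ℤ → ℤ} (he : StrictMono e) (m : ℤ) :
    ∃ n, e n ≤ m ∧ m < e (n + 1) := by
  obtain ⟨n, h1, h2⟩ := exists_last_int (P := fun n => e n ≤ m)
    ⟨min 0 (m - e 0), by
      have := sub_le_sub_of_strictMono he (show min 0 (m - e 0) ≤ 0 by omega)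
      omega⟩
    ⟨max 0 (m - e 0), fun n hn => by
      by_contra! h
      have := sub_le_sub_of_strictMono he (show 0 ≤ n by omega)
      omega⟩
  exact ⟨n, h1, not_le.1 h2⟩

theorem block_unique {α : Type*} [Preorder α] {e : ℤ → α} (he : Monotone e) {m : α} {n n' : ℤ}
    (h1 : e n ≤ m) (h2 : m < e (n + 1)) (h1' : e n' ≤ m) (h2' : m < e (n' + 1)) : n = n' := by
  by_contra h
  rcases lt_or_gt_of_ne h with h | h
  · exact lt_irrefl _ (h2.trans_le ((he (show n + 1 ≤ n' by omega)).trans h1'))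
  · exact lt_irrefl _ (h2'.trans_le ((he (show n' + 1 ≤ n by omega)).trans h1))

theorem strictMono_of_blocks {α : Type*} {b : ℤ → List α} (hb : ∀ n, b n ≠ []) {e : ℤ → ℤ}
    (he : ∀ n, e (n + 1) = e n + (b n).length) : StrictMono e :=
  strictMono_int_of_lt_succ fun n => by
    have := List.length_pos_iff.2 (hb n)
    have := he n
    omega

/-- A bi-infinite sequence of nonempty lists can be concatenated to a bi-infinite sequence. -/
theorem exists_concat {α : Type*} (b : ℤ → List α) (hb : ∀ n, b n ≠ []) (n₀ m₀ : ℤ) :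
    ∃ (f : ℤ → α) (e : ℤ → ℤ), e n₀ = m₀ ∧ (∀ n, e (n + 1) = e n + (b n).length) ∧
      ∀ n (i : ℕ) (hi : i < (b n).length), f (e n + i) = (b n)[i] := by
  obtain ⟨e, he0, he⟩ := exists_int_sum (fun n => ((b n).length : ℤ)) n₀ m₀
  have hmono := strictMono_of_blocks hb he
  choose p hp1 hp2 using exists_block hmono
  have hlt : ∀ m, (m - e (p m)).toNat < (b (p m)).length := fun m => by
    have := hp1 m; have := hp2 m; have := he (p m); omega
  refine ⟨fun m => (b (p m))[(m - e (p m)).toNat]'(hlt m), e, he0, he, ?_⟩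
  intro n i hi
  have hn : p (e n + i) = n := block_unique hmono.monotone (hp1 _) (hp2 _) (by omega)
    (by have := he n; omega)
  have key : ∀ (q : ℤ) (k : ℕ) (hk : k < (b q).length), q = n → k = i → (b q)[k] = (b n)[i] := by
    rintro q k hk rfl rfl; rfl
  exact key _ _ _ hn (by rw [hn]; omega)

/-- A relation between consecutive entries of a concatenation. -/
theorem rel_concat {α : Type*} {R : α → α → Prop} {b : ℤ → List α} (hb : ∀ n, b n ≠ [])
    {f : ℤ → α} {e : ℤ → ℤ} (he : ∀ n, e (n + 1) = e n + (b n).length)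
    (hf : ∀ n (i : ℕ) (hi : i < (b n).length), f (e n + i) = (b n)[i])
    (hR : ∀ n, List.IsChain R (b n ++ [f (e (n + 1))])) (m : ℤ) : R (f m) (f (m + 1)) := by
  obtain ⟨n, h1, h2⟩ := exists_block (strictMono_of_blocks hb he) m
  obtain ⟨i, rfl⟩ : ∃ i : ℕ, m = e n + i := ⟨(m - e n).toNat, by omega⟩
  have hi : i < (b n).length := by have := he n; omega
  have h := List.isChain_iff_getElem.1 (hR n) i (by simp; omega)
  rw [List.getElem_append_left hi, ← hf n i hi] at h
  rcases (Nat.succ_le_of_lt hi).lt_or_eq with hi' | hi'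
  · rw [List.getElem_append_left hi', ← hf n _ hi'] at h
    convert h using 2
    push_cast
    ring
  · rw [List.getElem_append_right (by omega)] at h
    have h3 : e n + i + 1 = e (n + 1) := by have := he n; omega
    rw [h3]
    simpa using h

theorem periodic_concat {α : Type*} {b : ℤ → List α} (hb : ∀ n, b n ≠ [])
    {f : ℤ → α} {e : ℤ → ℤ} (he : ∀ n, e (n + 1) = e n + (b n).length)
    (hf : ∀ n (i : ℕ) (hi : i < (b n).length), f (e n + i) = (b n)[i])
    {N : ℤ} (hN : 0 < N) (hper : ∀ n, b (n + N) = b n) : ∃ K > 0, ∀ m, f (m + K) = f m := by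
  have hmono := strictMono_of_blocks hb he
  -- The total length of `N` successive blocks does not depend on where they start; this length is
  -- the period.
  have hc : ∀ n, e (n + N) - e n = e (0 + N) - e 0 := by
    intro n
    induction n using Int.induction_on with
    | zero => rfl
    | succ k ih =>
      have h1 := he k
      have h2 := he (k + N)
      rw [hper] at h2
      rw [show (k : ℤ) + 1 + N = k + N + 1 by ring]
      omega
    | pred k ih =>
      have h1 := he (-k - 1)
      have h2 := he (-k - 1 + N)
      rw [hper] at h2
      rw [show -(k : ℤ) - 1 + N + 1 = -k + N by ring] at h2
      rw [show -(k : ℤ) - 1 + 1 = -k by ring] at h1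
      omega
  refine ⟨e (0 + N) - e 0, by have := hmono (show (0 : ℤ) < 0 + N by omega); omega, fun m => ?_⟩
  obtain ⟨n, h1, h2⟩ := exists_block hmono m
  obtain ⟨i, rfl⟩ : ∃ i : ℕ, m = e n + i := ⟨(m - e n).toNat, by omega⟩
  have hi : i < (b n).length := by have := he n; omega
  have h3 := hf (n + N) i (by rw [hper]; exact hi)
  rw [show e n + i + (e (0 + N) - e 0) = e (n + N) + i by have := hc n; omega, h3, hf n i hi]
  simp only [hper]

/-! ### Orbits across the sides of the octagon -/

/-- `l` lists, up to a common factor, the widths of the sides of the octagon as they are seen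
along a direction in the sector `[0, π/8]`. -/
structure IsWidths (l : Letter → ℝ) : Prop where
  nonneg : 0 ≤ l .A
  le : l .A ≤ l .D
  pos : 0 < l .C
  sqrt_mul_A : √2 * l .A = l .B - l .D
  sqrt_mul_C : √2 * l .C = l .B + l .D

namespace IsWidths

variable {l : Letter → ℝ} (h : IsWidths l)
include h

theorem sqrt_mul_B : √2 * l .B = l .C + l .A := by
  have := Real.mul_self_sqrt (show (0 : ℝ) ≤ 2 by norm_num)
  linear_combination (-√2 / 2) * (h.sqrt_mul_A + h.sqrt_mul_C) + (l .A + l .C) / 2 * this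

theorem sqrt_mul_D : √2 * l .D = l .C - l .A := by
  have := Real.mul_self_sqrt (show (0 : ℝ) ≤ 2 by norm_num)
  linear_combination (√2 / 2) * (h.sqrt_mul_A - h.sqrt_mul_C) + (l .C - l .A) / 2 * this

theorem D_le_B : l .D ≤ l .B := by
  have := mul_nonneg (Real.sqrt_nonneg 2) h.nonneg
  linarith [h.sqrt_mul_A]

theorem B_le_C : l .B ≤ l .C := by
  have h1 : 1 ≤ √2 := Real.one_le_sqrt.2 (by norm_num)
  have := mul_nonneg (sub_nonneg.2 h1) (sub_nonneg.2 h.le)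
  linarith [h.sqrt_mul_A, h.sqrt_mul_D]

end IsWidths

/-- The transversal coordinate of the midpoint of a side, in the units of `IsWidths`. -/
def midpoint (l : Letter → ℝ) : Letter → ℝ
  | .A => l .B + l .C + l .D
  | .B => l .D + l .C - l .A
  | .C => l .D - l .A - l .B
  | .D => -(l .A + l .B + l .C)

/-- A line in the direction given by `l` crosses successively the sides `p.1` and `q.1`, at the
transversal distances `p.2` and `q.2` from their midpoints. -/
def Crosses (l : Letter → ℝ) (p q : Letter × ℝ) : Prop :=
  EdgeZero p.1 q.1 ∧ |p.2| < l p.1 ∧ q.2 = p.2 - midpoint l p.1 - midpoint l q.1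

/-- `u` is the coding of a periodic orbit in some direction in the sector `[0, π/8]`. -/
def PeriodicOrbit (u : Word) : Prop :=
  ∃ l, IsWidths l ∧ ∃ f : ℤ → Letter × ℝ, (∀ n, (f n).1 = u n) ∧
    (∀ n, Crosses l (f n) (f (n + 1))) ∧ ∃ N > 0, ∀ n, f (n + N) = f n

/-! ### Words of period two -/

theorem EdgeZero.symm {P Q : Letter} (h : EdgeZero P Q) : EdgeZero Q P := by
  revert h
  cases P <;> cases Q <;> simp [EdgeZero]

theorem periodicOrbit_alternating {P Q : Letter} (hPQ : EdgeZero P Q) {u : Word} {m : ℤ}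
    (hu : ∀ n, u n = if Even (n - m) then P else Q) : PeriodicOrbit u := by
  obtain ⟨l, hl, hP, hQ, hmid⟩ : ∃ l, IsWidths l ∧ 0 < l P ∧ 0 < l Q ∧
      midpoint l P + midpoint l Q = 0 := by
    have h2 := Real.mul_self_sqrt (show (0 : ℝ) ≤ 2 by norm_num)
    have h0 : (0 : ℝ) < √2 := by positivity
    -- Direction 0, for the edges between `B` and `D` and for the loop at `C`.
    have hl : IsWidths (fun | .A => 0 | .B => 1 | .C => √2 | .D => 1) :=
      ⟨le_rfl, zero_le_one, h0, by simp, by simp only; linarith⟩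
    -- Direction π/8, for the edges between `A` and `D` and between `B` and `C`.
    have hl' : IsWidths (fun | .A => 1 | .B => 1 + √2 | .C => 1 + √2 | .D => 1) :=
      ⟨zero_le_one, le_rfl, by simp only; linarith, by simp, by simp only; linarith⟩
    cases P <;> cases Q <;> first
      | (simp [EdgeZero] at hPQ; done)
      | (refine ⟨_, hl, ?_, ?_, ?_⟩ <;> simp only [midpoint] <;> linarith)
      | (refine ⟨_, hl', ?_, ?_, ?_⟩ <;> simp only [midpoint] <;> linarith)
  refine ⟨l, hl, fun n => (u n, 0), fun n => rfl, fun n => ?_, 2, by norm_num, fun n => ?_⟩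
  · have hsucc : Even (n + 1 - m) ↔ ¬ Even (n - m) := by
      rw [show n + 1 - m = n - m + 1 by ring, Int.even_add_one]
    simp only [Crosses, hu, hsucc, abs_zero]
    by_cases h : Even (n - m) <;> simp only [h, if_true, if_false, not_true, not_false_eq_true]
    · exact ⟨hPQ, hP, by linarith⟩
    · exact ⟨hPQ.symm, hQ, by linarith⟩
  · have : Even (n + 2 - m) ↔ Even (n - m) := by
      rw [show n + 2 - m = n - m + 2 by ring, Int.even_add]
      simp
    simp only [hu, this]

/-! ### Generation of orbits -/

/-- The signed widths of the sides along a direction in the `j`-th sector, where `l` gives the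
widths after this sector is carried to `[0, π/8]`. -/
def signedWidths (j : Fin 8) (l : Letter → ℝ) : Letter → ℝ
  | .A => l (sectorPerm j .A)
  | .B => if (j : ℕ) ≤ 5 then l (sectorPerm j .B) else -l (sectorPerm j .B)
  | .C => if (j : ℕ) ≤ 3 then l (sectorPerm j .C) else -l (sectorPerm j .C)
  | .D => if (j : ℕ) ≤ 1 then l (sectorPerm j .D) else -l (sectorPerm j .D)

/-- The widths after the affine automorphism that carries the sectors `1, …, 7` to the
sector `0`. -/
def renormalizedWidths (p : Letter → ℝ) : Letter → ℝ
  | .A => p .A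
  | .B => 2 * p .A + p .B - 2 * p .D
  | .C => 2 * p .A - p .C + 2 * p .B - 2 * p .D
  | .D => 2 * p .A - p .D

/-- The orientation of the isometry that carries the `j`-th sector to `[0, π/8]`, followed by the
affine automorphism. -/
def orientation (j : Fin 8) : ℝ := if (j : ℕ) % 2 = 0 then -1 else 1

/-- The sides `L, L', …`, with the positions at which a line crosses them that crosses the first
one at `x`. -/
def crossings (l : Letter → ℝ) : ℝ → Letter → List Letter → List (Letter × ℝ)
  | x, L, [] => [(L, x)]
  | x, L, L' :: r => (L, x) :: crossings l (x - midpoint l L - midpoint l L') L' r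

theorem crossings_ne_nil (l : Letter → ℝ) (x : ℝ) (L : Letter) (r : List Letter) :
    crossings l x L r ≠ [] := by
  cases r <;> simp [crossings]

theorem map_fst_crossings (l : Letter → ℝ) (x : ℝ) (L : Letter) (r : List Letter) :
    (crossings l x L r).map Prod.fst = L :: r := by
  induction r generalizing x L with
  | nil => rfl
  | cons L' r ih => simp [crossings, ih]

theorem head_crossings (l : Letter → ℝ) (x : ℝ) (L : Letter) (r : List Letter)
    (h : 0 < (crossings l x L r).length) : (crossings l x L r)[0] = (L, x) := by
  cases r <;> rfl

theorem sectorPerm_apply :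
    (sectorPerm 1 .A = .D ∧ sectorPerm 1 .B = .C ∧ sectorPerm 1 .C = .B ∧ sectorPerm 1 .D = .A) ∧
    (sectorPerm 2 .A = .B ∧ sectorPerm 2 .B = .C ∧ sectorPerm 2 .C = .D ∧ sectorPerm 2 .D = .A) ∧
    (sectorPerm 3 .A = .C ∧ sectorPerm 3 .B = .B ∧ sectorPerm 3 .C = .A ∧ sectorPerm 3 .D = .D) ∧
    (sectorPerm 4 .A = .C ∧ sectorPerm 4 .B = .D ∧ sectorPerm 4 .C = .A ∧ sectorPerm 4 .D = .B) ∧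
    (sectorPerm 5 .A = .B ∧ sectorPerm 5 .B = .A ∧ sectorPerm 5 .C = .D ∧ sectorPerm 5 .D = .C) ∧
    (sectorPerm 6 .A = .D ∧ sectorPerm 6 .B = .A ∧ sectorPerm 6 .C = .B ∧ sectorPerm 6 .D = .C) ∧
    (sectorPerm 7 .A = .A ∧ sectorPerm 7 .B = .D ∧ sectorPerm 7 .C = .C ∧ sectorPerm 7 .D = .B) := by
  decide

/-- For the velocity (x, y) the signed widths have x at `C` and y at `A`, and the new ones belong to
(-x + 2(1 + √2)y, y). This linear map reverses orientation and carries the directions in [π/8, π]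
onto [0, π/8]. -/
theorem isWidths_renormalizedWidths {j : Fin 8} (hj : j ≠ 0) {l : Letter → ℝ} (h : IsWidths l) :
    IsWidths (renormalizedWidths (signedWidths j l)) := by
  have h1 := h.nonneg
  have h2 := h.le
  have h3 := h.pos
  have h4 := h.sqrt_mul_A
  have h5 := h.sqrt_mul_B
  have h6 := h.sqrt_mul_C
  have h7 := h.sqrt_mul_D
  have h8 := h.D_le_B
  have h9 := h.B_le_C
  fin_cases j
  · exact absurd rfl hj
  all_goals
    constructor <;> simp [renormalizedWidths, signedWidths, sectorPerm_apply] <;> linarith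

-- The image of one segment between sides under the affine automorphism, cut where it meets the
-- sides. For each edge of each diagram, the bounds at the new crossings follow linearly from those
-- at the two ends and from 0 ≤ A ≤ D ≤ B ≤ C for the widths.
set_option maxHeartbeats 2000000 in
theorem isChain_crossings {j : Fin 8} (hj : j ≠ 0) {l : Letter → ℝ} (h : IsWidths l)
    {L L' : Letter} (hL : Edge j L L') {x x' : ℝ}
    (hx : |x| < l (sectorPerm j L)) (hx' : |x'| < l (sectorPerm j L'))
    (hxx' : x' = x - midpoint l (sectorPerm j L) - midpoint l (sectorPerm j L')) :
    List.IsChain (Crosses (renormalizedWidths (signedWidths j l)))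
      (crossings (renormalizedWidths (signedWidths j l)) (orientation j * x) L
        (interpolation j L L') ++ [(L', orientation j * x')]) := by
  have h1 := h.nonneg
  have h2 := h.le
  have h3 := h.pos
  have h8 := h.D_le_B
  have h9 := h.B_le_C
  subst hxx'
  rw [abs_lt] at hx hx'
  fin_cases j
  · exact absurd rfl hj
  all_goals
    cases L <;> cases L' <;> first
      | (simp [Edge, EdgeZero, sectorPerm_apply] at hL; done)
      | simp [midpoint, sectorPerm_apply] at hx hx'
        simp [interpolation, crossings, Crosses, EdgeZero, orientation, midpoint,
          renormalizedWidths, signedWidths, sectorPerm_apply, abs_lt]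
        obtain ⟨a1, a2⟩ := hx
        obtain ⟨a3, a4⟩ := hx'
        and_intros <;> linarith

/-! ### Generation of words -/

/-- `W` arises from `v` by interpolation in diagram `j`, and the `n`-th letter of `v` is found at
the place `e n` of `W`. -/
def Interpolates (j : Fin 8) (v W : Word) (e : ℤ → ℤ) : Prop :=
  ∀ n : ℤ, W (e n) = v n ∧
    e (n + 1) = e n + 1 + ((interpolation j (v n) (v (n + 1))).length : ℤ) ∧
    ∀ i : Fin (interpolation j (v n) (v (n + 1))).length,
      W (e n + 1 + (i : ℕ)) = (interpolation j (v n) (v (n + 1))).get i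

theorem PeriodicOrbit.edgeZero {u : Word} (h : PeriodicOrbit u) (n : ℤ) :
    EdgeZero (u n) (u (n + 1)) := by
  obtain ⟨l, -, f, hf, hc, -⟩ := h
  rw [← hf, ← hf]
  exact (hc n).1

/-- The pieces of `isChain_crossings` fit together because each ends where the next begins. The free
choice of `e n₀` later serves to align windows. -/
theorem exists_interpolates {j : Fin 8} (hj : j ≠ 0) {v : Word}
    (h : PeriodicOrbit (permute (sectorPerm j) v)) (n₀ m₀ : ℤ) :
    ∃ (W : Word) (e : ℤ → ℤ), e n₀ = m₀ ∧ Interpolates j v W e ∧ PeriodicOrbit W := by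
  have hadm : ∀ n, Edge j (v n) (v (n + 1)) := h.edgeZero
  obtain ⟨l, hl, f, hf, hc, N, hN, hper⟩ := h
  have hf' : ∀ n, (f n).1 = sectorPerm j (v n) := hf
  have hv : ∀ n, v (n + N) = v n := fun n => (sectorPerm j).injective (by
    rw [← hf', ← hf', hper])
  set l' := renormalizedWidths (signedWidths j l)
  set b : ℤ → List (Letter × ℝ) := fun n =>
    crossings l' (orientation j * (f n).2) (v n) (interpolation j (v n) (v (n + 1))) with hbdef
  have hb : ∀ n, b n ≠ [] := fun n => crossings_ne_nil _ _ _ _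
  have hmap : ∀ n, (b n).map Prod.fst = v n :: interpolation j (v n) (v (n + 1)) := fun n =>
    map_fst_crossings _ _ _ _
  have hlen : ∀ n, (b n).length = (interpolation j (v n) (v (n + 1))).length + 1 := fun n => by
    rw [← List.length_map (f := Prod.fst), hmap, List.length_cons]
  obtain ⟨g, e, he0, he, hg⟩ := exists_concat b hb n₀ m₀
  have hfst : ∀ n (i : ℕ) (hi : i < (v n :: interpolation j (v n) (v (n + 1))).length),
      (g (e n + i)).1 = (v n :: interpolation j (v n) (v (n + 1)))[i] := fun n i hi => by
    have hi' : i < (b n).length := by rw [hlen]; simpa using hi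
    rw [hg n i hi']
    simp only [← hmap, List.getElem_map]
  have hstart : ∀ n, g (e n) = (v n, orientation j * (f n).2) := fun n => by
    have := hg n 0 (List.length_pos_iff.2 (hb n))
    rw [Nat.cast_zero, add_zero] at this
    rw [this]
    exact head_crossings _ _ _ _ _
  refine ⟨fun m => (g m).1, e, he0, fun n => ⟨by simp [hstart], by rw [he, hlen]; push_cast; ring,
    fun i => ?_⟩, l', isWidths_renormalizedWidths hj hl, g, fun _ => rfl, ?_, ?_⟩
  · have := hfst n (i + 1) (by simp)
    simp only [List.getElem_cons_succ] at this
    rw [List.get_eq_getElem, ← this]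
    push_cast
    congr 2
    ring
  · refine rel_concat hb he hg fun n => ?_
    rw [hstart]
    have h1 := (hc n).2.1
    have h2 := (hc (n + 1)).2.1
    have h3 := (hc n).2.2
    rw [hf'] at h1 h2
    rw [hf', hf'] at h3
    exact isChain_crossings hj hl (hadm n) h1 h2 h3
  · obtain ⟨K, hK, hKper⟩ := periodic_concat hb he hg hN fun n => by
      simp only [hbdef]
      rw [show n + N + 1 = n + 1 + N by ring, hv, hv, hper]
    exact ⟨K, hK, hKper⟩

/-- Each inserted word depends only on the two letters around it, so the anchor at `n₀` and the
letters from `n₀` to `n₁` determine the places and the letters in between. -/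
theorem Interpolates.eq_on {j : Fin 8} {v v' W W' : Word} {e e' : ℤ → ℤ}
    (h : Interpolates j v W e) (h' : Interpolates j v' W' e') {n₀ n₁ : ℤ}
    (hv : ∀ n, n₀ ≤ n → n ≤ n₁ → v' n = v n) (he : e' n₀ = e n₀) {m : ℤ}
    (hm₀ : e n₀ ≤ m) (hm₁ : m ≤ e n₁) : W' m = W m := by
  have hmono : StrictMono e := strictMono_int_of_lt_succ fun n => by
    have := (h n).2.1
    omega
  have hee : ∀ n, n₀ ≤ n → n ≤ n₁ → e' n = e n := by
    intro n hn
    induction n, hn using Int.leInduction with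
    | base => exact fun _ => he
    | succ n hn ih =>
      intro hn'
      rw [(h n).2.1, (h' n).2.1, ih (by omega), hv n hn (by omega), hv (n + 1) (by omega) hn']
  obtain ⟨n, hn, hn'⟩ := exists_block hmono m
  have h1 : n₀ ≤ n := by
    by_contra! hlt
    have := hmono.monotone (show n + 1 ≤ n₀ by omega)
    omega
  have h2 : n ≤ n₁ := hmono.le_iff_le.1 (hn.trans hm₁)
  rcases hn.eq_or_lt with rfl | hlt
  · rw [(h n).1, ← hee n h1 h2, (h' n).1, hv n h1 h2]
  · have h3 : n < n₁ := hmono.lt_iff_lt.1 (hlt.trans_le hm₁)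
    have h4 := (h n).2.1
    obtain ⟨i, rfl⟩ : ∃ i : ℕ, m = e n + 1 + i := ⟨(m - (e n + 1)).toNat, by omega⟩
    have hi : i < (interpolation j (v n) (v (n + 1))).length := by omega
    rw [(h n).2.2 ⟨i, hi⟩]
    have h5 := (h' n).2.2
    rw [hv n h1 h2, hv (n + 1) (by omega) (by omega), hee n h1 h2] at h5
    exact h5 ⟨i, hi⟩

/-! ### Coherent words are generated by their derived words -/

instance : Fintype Letter where
  elems := {.A, .B, .C, .D}
  complete := by intro x; cases x <;> decide

instance : DecidableRel EdgeZero := fun L L' =>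
  inferInstanceAs (Decidable ((L, L') ∈ ([(.A, .D), (.D, .A), (.D, .B), (.B, .D), (.B, .C),
    (.C, .B), (.C, .C)] : List (Letter × Letter))))

instance (i : Fin 8) : DecidableRel (Edge i) := fun L L' =>
  inferInstanceAs (Decidable (EdgeZero (sectorPerm i L) (sectorPerm i L')))

/-- The path `A D B C C B D A`, the longest one in `𝒟₀` without sandwiched inner letters. -/
def freePath : ℕ → Letter
  | 0 => .A
  | 1 => .D
  | 2 => .B
  | 3 => .C
  | 4 => .C
  | 5 => .B
  | 6 => .D
  | _ => .A

/-- The place of an edge of `𝒟₀` in `freePath`. -/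
def edgeRank : Letter → Letter → ℕ
  | .D, .B => 1
  | .B, .C => 2
  | .C, .C => 3
  | .C, .B => 4
  | .B, .D => 5
  | .D, .A => 6
  | _, _ => 0

theorem freePath_edgeRank : ∀ L L', EdgeZero L L' → freePath (edgeRank L L') = L := by decide

/-- A path in `𝒟₀` that does not turn back at a letter has only one continuation, the next edge of
`freePath`. -/
theorem edgeRank_succ : ∀ L L' L'', EdgeZero L L' → EdgeZero L' L'' → L ≠ L'' →
    edgeRank L' L'' = edgeRank L L' + 1 := by decide

/-- The group prescribes the edge by which a path leaves the sandwiched letter `L` and the edge by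
which it enters `L'`. The interpolating word is the stretch of `freePath` between these two edges.
-/
theorem interpolation_eq : ∀ j : Fin 8, j ≠ 0 → ∀ k : Fin 4, (k : ℕ) = (j : ℕ) / 2 → ∀ L L',
    Edge j L L' → EdgeZero L (sandwichGroup k L) → EdgeZero (sandwichGroup k L') L' →
    edgeRank L (sandwichGroup k L) ≤ edgeRank (sandwichGroup k L') L' →
    interpolation j L L' =
      (List.range (edgeRank (sandwichGroup k L') L' - edgeRank L (sandwichGroup k L))).map
        fun i => freePath (edgeRank L (sandwichGroup k L) + 1 + i) := by
  decide +kernel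

theorem edgeRank_add {x : Word} (hx : ∀ n, EdgeZero (x n) (x (n + 1))) {p : ℤ} {i : ℕ}
    (h : ∀ q, p < q → q ≤ p + i → ¬ SandwichedAt x q) :
    edgeRank (x (p + i)) (x (p + i + 1)) = edgeRank (x p) (x (p + 1)) + i := by
  induction i with
  | zero => simp
  | succ i ih =>
    have h1 := h (p + i + 1) (by omega) (by push_cast; omega)
    rw [SandwichedAt, add_sub_cancel_right] at h1
    have h2 := edgeRank_succ _ _ _ (hx (p + i)) (hx (p + i + 1)) h1
    push_cast
    rw [← add_assoc, h2, ih fun q hq hq' => h q hq (by push_cast; omega)]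
    ring

/-- Between consecutive sandwiched letters the word never turns back, so it runs along `freePath`,
and its group fixes where it starts and stops. -/
theorem interpolates_of_sandwiched {j : Fin 8} (hj : j ≠ 0) {x v : Word}
    (hx : ∀ n, EdgeZero (x n) (x (n + 1))) {e : ℤ → ℤ} (he : StrictMono e)
    (hrange : Set.range e = {n | SandwichedAt x n}) (hv : ∀ n, v n = x (e n))
    (hadm : AdmissibleIn j v) {k : Fin 4} (hk : (k : ℕ) = (j : ℕ) / 2)
    (hs : ∀ n, SandwichedAt x n → x (n - 1) = sandwichGroup k (x n)) :
    Interpolates j v x e := by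
  intro n
  have hsand : ∀ n, SandwichedAt x (e n) := fun n => by
    have : e n ∈ Set.range e := ⟨n, rfl⟩
    rwa [hrange] at this
  -- `i` counts the letters strictly between two consecutive sandwiched ones.
  obtain ⟨i, hi⟩ : ∃ i : ℕ, e (n + 1) = e n + i + 1 :=
    ⟨(e (n + 1) - e n - 1).toNat, by have := he (show n < n + 1 by omega); omega⟩
  have hfree : ∀ q, e n < q → q ≤ e n + i → ¬ SandwichedAt x q := by
    intro q h1 h2 h3
    have : q ∈ Set.range e := by rw [hrange]; exact h3
    obtain ⟨r, rfl⟩ := this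
    have h4 := he.lt_iff_lt.1 h1
    have h5 : r < n + 1 := he.lt_iff_lt.1 (by omega)
    omega
  have hg1 : sandwichGroup k (x (e n)) = x (e n + 1) := by
    rw [← hs _ (hsand n)]; exact hsand n
  have hg2 : sandwichGroup k (x (e n + i + 1)) = x (e n + i) := by
    have := hs _ (hsand (n + 1))
    rw [hi, add_sub_cancel_right] at this
    exact this.symm
  have hrank := edgeRank_add hx hfree
  have hint : interpolation j (v n) (v (n + 1)) =
      (List.range i).map fun t => freePath (edgeRank (x (e n)) (x (e n + 1)) + 1 + t) := by
    have hE := hadm n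
    rw [hv, hv, hi] at hE ⊢
    have := interpolation_eq j hj k hk _ _ hE (by rw [hg1]; exact hx _) (by rw [hg2]; exact hx _)
      (by rw [hg1, hg2, hrank]; omega)
    rw [this, hg1, hg2, hrank, Nat.add_sub_cancel_left]
  refine ⟨(hv n).symm, by rw [hint, hi]; simp; ring, ?_⟩
  rw [hint]
  intro t
  have ht : (t : ℕ) < i := by simpa using t.2
  have h1 := edgeRank_add hx (i := t + 1) fun q hq hq' => hfree q hq (by push_cast at hq'; omega)
  have h2 := freePath_edgeRank _ _ (hx (e n + (t + 1 : ℕ)))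
  rw [h1] at h2
  simp only [List.get_eq_getElem, List.getElem_map, List.getElem_range]
  rw [show edgeRank (x (e n)) (x (e n + 1)) + 1 + t = edgeRank (x (e n)) (x (e n + 1)) + (t + 1) by
    ring, h2]
  congr 1
  push_cast
  ring

/-! ### Finite windows of infinitely coherent words -/

theorem isGenerated_of_interpolates {j i : Fin 8} {v W : Word} {e : ℤ → ℤ}
    (hv : AdmissibleIn j v) (h : Interpolates j v W e) :
    IsGenerated j i v (permute (sectorPerm i)⁻¹ W) :=
  ⟨W, ⟨hv, e, h⟩, rfl⟩

theorem CoherentWith.exists_interpolates {w v : Word} {i j : Fin 8} (h : CoherentWith w i j)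
    (hv : IsDerived (permute (sectorPerm i) w) v) (hadm : AdmissibleIn j v) :
    ∃ e : ℤ → ℤ, StrictMono e ∧ Set.range e = {n | SandwichedAt w n} ∧
      Interpolates j v (permute (sectorPerm i) w) e := by
  obtain ⟨-, hw, -, hj, k, hk, hs⟩ := h
  obtain ⟨e, he, hrange, hve⟩ := hv
  refine ⟨e, he, ?_, interpolates_of_sandwiched hj hw he hrange hve hadm hk hs⟩
  rw [hrange]
  ext n
  exact (sectorPerm i).injective.eq_iff

theorem eq_alternating {w : Word} {m : ℤ} {D : ℕ}
    (h : ∀ i, m < i → i < m + D → SandwichedAt w i) (i : ℕ) (hi : i ≤ D) :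
    w (m + i) = if Even (i : ℤ) then w m else w (m + 1) := by
  induction i using Nat.twoStepInduction with
  | zero => simp
  | one => simp
  | more i ih _ =>
    have h1 := h (m + i + 1) (by omega) (by omega)
    rw [SandwichedAt, add_sub_cancel_right] at h1
    have h2 : Even ((i + 2 : ℕ) : ℤ) ↔ Even (i : ℤ) := by
      push_cast; rw [Int.even_add]; simp
    simp only [h2]
    rw [← ih (by omega), h1]
    congr 1
    push_cast
    ring

theorem exists_shortPeriodic {w : Word} {i : Fin 8} (hw : AdmissibleIn i w) {m : ℤ} {D : ℕ}
    (h : ∀ n, m < n → n < m + D → SandwichedAt w n) :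
    ∃ u ∈ shortPeriodic i, PeriodicOrbit (permute (sectorPerm i) u) ∧
      ∀ n, m ≤ n → n ≤ m + D → u n = w n := by
  have horbit : PeriodicOrbit (permute (sectorPerm i)
      fun n => if Even (n - m) then w m else w (m + 1)) :=
    periodicOrbit_alternating (m := m) (hw m) fun n => by simp only [permute]; split_ifs <;> rfl
  refine ⟨_, ⟨horbit.edgeZero, fun n => ?_⟩, horbit, fun n h1 h2 => ?_⟩
  · have : Even (n + 2 - m) ↔ Even (n - m) := by
      rw [show n + 2 - m = n - m + 2 by ring, Int.even_add]
      simp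
    simp only [this]
  · obtain ⟨k, rfl⟩ : ∃ k : ℕ, n = m + k := ⟨(n - m).toNat, by omega⟩
    rw [eq_alternating h k (by omega), add_sub_cancel_left]

/-- Few letters of the derived word suffice to generate a window that contains a letter which is
not sandwiched. -/
theorem exists_shorter_window {e : ℤ → ℤ} (he : StrictMono e) {m : ℤ} {D : ℕ} {i : ℤ}
    (h1 : m < i) (h2 : i < m + D) (hi : i ∉ Set.range e) :
    ∃ n : ℤ, ∃ d : ℕ, d < D ∧ e n ≤ m ∧ m + D ≤ e (n + d) := by
  obtain ⟨n₀, hn₀, hn₀'⟩ := exists_block he m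
  obtain ⟨n₁, hn₁, hn₁'⟩ := exists_block he (m + D - 1)
  have hsub : (Finset.Ioo n₀ (n₁ + 1)).image e ⊆ (Finset.Ioo m (m + D)).erase i := by
    intro q hq
    obtain ⟨r, hr, rfl⟩ := Finset.mem_image.1 hq
    rw [Finset.mem_Ioo] at hr
    have h3 := he.monotone (show n₀ + 1 ≤ r by omega)
    have h4 := he.monotone (show r ≤ n₁ by omega)
    rw [Finset.mem_erase, Finset.mem_Ioo]
    exact ⟨fun h => hi ⟨r, h⟩, by omega, by omega⟩
  have hcard := Finset.card_le_card hsub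
  rw [Finset.card_image_of_injective _ he.injective,
    Finset.card_erase_of_mem (Finset.mem_Ioo.2 ⟨h1, h2⟩), Int.card_Ioo, Int.card_Ioo] at hcard
  have h5 : n₀ < n₁ + 1 := he.lt_iff_lt.1 (by omega)
  refine ⟨n₀, (n₁ + 1 - n₀).toNat, by omega, hn₀, ?_⟩
  rw [show n₀ + ((n₁ + 1 - n₀).toNat : ℤ) = n₁ + 1 by omega]
  omega

theorem exists_generatedPeriodic (D : ℕ) : ∀ (s : ℕ → Fin 8) (W : ℕ → Word) (m : ℤ),
    (∀ k, IsDerived (permute (sectorPerm (s k)) (W k)) (W (k + 1))) →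
    (∀ k, CoherentWith (W k) (s k) (s (k + 1))) →
    ∃ k, ∃ v ∈ generatedPeriodic k s, PeriodicOrbit (permute (sectorPerm (s 0)) v) ∧
      ∀ n, m ≤ n → n ≤ m + D → v n = W 0 n := by
  induction D using Nat.strong_induction_on with
  | _ D ih =>
    intro s W m hder hcoh
    by_cases hsand : ∀ n, m < n → n < m + D → SandwichedAt (W 0) n
    · obtain ⟨u, hu, horbit, heq⟩ := exists_shortPeriodic (hcoh 0).2.1 hsand
      exact ⟨0, u, hu, horbit, heq⟩
    · push Not at hsand
      obtain ⟨i, hi₁, hi₂, hi⟩ := hsand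
      obtain ⟨e, he, hrange, hint⟩ :=
        (hcoh 0).exists_interpolates (hder 0) (hcoh 1).2.1
      obtain ⟨n, d, hd, hn, hn'⟩ := exists_shorter_window he hi₁ hi₂ (by rwa [hrange])
      obtain ⟨k, v, hv, horbit, heq⟩ := ih d hd (fun k => s (k + 1)) (fun k => W (k + 1)) n
        (fun k => hder (k + 1)) (fun k => hcoh (k + 1))
      -- Anchoring `n` at `e n` makes the generated word agree with the original one at the same
      -- indices.
      obtain ⟨W', e', he', hint', horbit'⟩ :=
        exists_interpolates (hcoh 0).2.2.2.1 horbit n (e n)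
      have hperm : permute (sectorPerm (s 0)) (permute (sectorPerm (s 0))⁻¹ W') = W' := by
        ext q; simp [permute]
      refine ⟨k + 1, _, ⟨v, hv, isGenerated_of_interpolates horbit.edgeZero hint'⟩,
        by rwa [hperm], fun q hq hq' => ?_⟩
      have := hint.eq_on hint' heq he' (hn.trans hq) (hq'.trans hn')
      simp [permute, this]

/-! ### Geometry of the octagon -/

theorem normal_eq (k : Fin 8) : normal k =
    (![((1 : ℝ), (0 : ℝ)), (√2 / 2, √2 / 2), (0, 1), (-(√2 / 2), √2 / 2), (-1, 0),
      (-(√2 / 2), -(√2 / 2)), (0, -1), (√2 / 2, -(√2 / 2))] : Fin 8 → ℝ × ℝ) k := by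
  have e2 : (2 : ℝ) * (Real.pi / 4) = Real.pi / 2 := by ring
  have e3 : (3 : ℝ) * (Real.pi / 4) = Real.pi - Real.pi / 4 := by ring
  have e4 : (4 : ℝ) * (Real.pi / 4) = Real.pi := by ring
  have e5 : (5 : ℝ) * (Real.pi / 4) = Real.pi / 4 + Real.pi := by ring
  have e6 : (6 : ℝ) * (Real.pi / 4) = Real.pi / 2 + Real.pi := by ring
  have e7 : (7 : ℝ) * (Real.pi / 4) = 2 * Real.pi - Real.pi / 4 := by ring
  fin_cases k <;>
    simp [normal, e2, e3, e4, e5, e6, e7, Real.cos_two_pi_sub, Real.sin_two_pi_sub]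

theorem height_add (k : Fin 8) (p q : ℝ × ℝ) : height k (p + q) = height k p + height k q := by
  simp only [height, Prod.fst_add, Prod.snd_add]; ring

theorem height_smul (k : Fin 8) (t : ℝ) (p : ℝ × ℝ) : height k (t • p) = t * height k p := by
  simp only [height, Prod.smul_fst, Prod.smul_snd, smul_eq_mul]; ring

/-- The point of the `k`-th side at the signed distance `s` from its midpoint. -/
noncomputable def sidePoint (k : Fin 8) (s : ℝ) : ℝ × ℝ :=
  normal k + s • (-(normal k).2, (normal k).1)

/-- With inradius 1, half a side has length tan(π/8) = √2 - 1. -/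
theorem sidePoint_mem_openSide {k : Fin 8} {s : ℝ} (hs : |s| < √2 - 1) :
    sidePoint k s ∈ openSide k := by
  have h2 := Real.mul_self_sqrt (show (0 : ℝ) ≤ 2 by norm_num)
  have h1 : √2 < 3 / 2 := by
    rw [Real.sqrt_lt' (by norm_num)]; norm_num
  rw [abs_lt] at hs
  obtain ⟨ha, hb⟩ := hs
  have h3 : √2 / 2 * (s + 1) < 1 := by nlinarith [Real.sqrt_nonneg 2]
  have h4 : √2 / 2 * (1 - s) < 1 := by nlinarith [Real.sqrt_nonneg 2]
  have h5 : 0 < √2 / 2 * (s + 1) := mul_pos (by positivity) (by linarith)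
  have h6 : 0 < √2 / 2 * (1 - s) := mul_pos (by positivity) (by linarith)
  have h7 : √2 * √2 * s = 2 * s := by rw [h2]
  constructor
  · fin_cases k <;> simp [sidePoint, height, normal_eq] <;> linarith
  · intro l hl
    fin_cases k <;> fin_cases l <;> first
      | exact absurd rfl hl
      | (simp [sidePoint, height, normal_eq]; done)
      | (simp [sidePoint, height, normal_eq]; linarith)

theorem sidePoint_sub (k : Fin 8) (s : ℝ) :
    sidePoint k s - (2 : ℝ) • normal k = sidePoint (k + 4) (-s) := by
  fin_cases k <;> ext <;> simp [sidePoint, normal_eq] <;> ring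

theorem openSide_height_le {k : Fin 8} {p : ℝ × ℝ} (hp : p ∈ openSide k) (l : Fin 8) :
    height l p ≤ 1 := by
  by_cases h : l = k
  · rw [h, hp.1]
  · exact (hp.2 l h).le

/-- Each height is affine along the segment and at most 1 at both ends. As the ends lie on different
open sides, it is less than 1 at one of them, hence strictly in between. -/
theorem segment_mem_interior {k l : Fin 8} (hkl : k ≠ l) {p v : ℝ × ℝ} {s t : ℝ}
    (hp : p ∈ openSide k) (hq : p + t • v ∈ openSide l) (hs : 0 < s) (hst : s < t) :
    p + s • v ∈ octagonInterior := by
  intro i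
  have h1 := openSide_height_le hp i
  have h2 := openSide_height_le hq i
  have h3 : height i p < 1 ∨ height i (p + t • v) < 1 := by
    by_cases h : i = k
    · exact Or.inr (hq.2 i (h ▸ hkl))
    · exact Or.inl (hp.2 i h)
  rw [height_add, height_smul] at h2 h3 ⊢
  have h4 : 0 < t * (1 - height i p - s * height i v) := by
    have : t * (1 - height i p - s * height i v) =
        (t - s) * (1 - height i p) + s * (1 - (height i p + t * height i v)) := by ring
    rw [this]
    rcases h3 with h3 | h3
    · exact add_pos_of_pos_of_nonneg (mul_pos (by linarith) (by linarith))
        (mul_nonneg hs.le (by linarith))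
    · exact add_pos_of_nonneg_of_pos (mul_nonneg (by linarith) (by linarith))
        (mul_pos hs (by linarith))
  linarith [pos_of_mul_pos_right h4 (hs.trans hst).le]

/-! ### Construction of periodic trajectories -/

theorem exists_periodic_trajectory {side : ℤ → Fin 8} {p : ℤ → ℝ × ℝ} {v : ℝ × ℝ} (hv : v ≠ 0)
    {d : ℤ → ℝ} (hd : ∀ n, 0 < d n) (hp : ∀ n, p n ∈ openSide (side n))
    {opp : ℤ → Fin 8} (hq : ∀ n, p n - (2 : ℝ) • normal (side n) ∈ openSide (opp n))
    (hopp : ∀ n, opp n ≠ side (n + 1))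
    (hstep : ∀ n, p (n + 1) = p n - (2 : ℝ) • normal (side n) + d n • v)
    {N : ℤ} (hN : 0 < N) (hside : ∀ n, side (n + N) = side n) (hpN : ∀ n, p (n + N) = p n)
    (hdN : ∀ n, d (n + N) = d n) :
    ∃ τ : LinearTrajectory, τ.IsPeriodic ∧ τ.side = side := by
  obtain ⟨time, ht0, ht⟩ := exists_int_sum d 0 0
  have hmono : StrictMono time := strictMono_int_of_lt_succ fun n => by
    rw [ht]; linarith [hd n]
  have hper : ∀ n, time (n + N) = time n + time N := by
    intro n
    induction n using Int.induction_on with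
    | zero => simp [ht0]
    | succ k ih =>
      rw [show (k : ℤ) + 1 + N = k + N + 1 by ring, ht, ih, hdN, ht]
      ring
    | pred k ih =>
      have h1 := ht (-k - 1)
      have h2 := ht (-k - 1 + N)
      rw [hdN, show -(k : ℤ) - 1 + N + 1 = -k + N by ring, ih] at h2
      rw [show -(k : ℤ) - 1 + 1 = -k by ring] at h1
      linarith
  have hT : 0 < time N := ht0 ▸ hmono hN
  -- Periodicity of the flight times makes the hitting times unbounded in both directions.
  have hmul : ∀ z : ℤ, time (z * N) = z * time N := by
    intro z
    induction z using Int.induction_on with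
    | zero => simp [ht0]
    | succ k ih =>
      rw [add_mul, one_mul, hper, ih]
      push_cast
      ring
    | pred k ih =>
      have := hper ((-k - 1) * N)
      rw [show (-(k : ℤ) - 1) * N + N = -k * N by ring, ih] at this
      push_cast at this ⊢
      linarith
  have htop : ∀ b, ∃ a, b ≤ time a := fun b => ⟨⌈b / time N⌉ * N, by
    rw [hmul, ← div_le_iff₀ hT]; exact Int.le_ceil _⟩
  have hbot : ∀ b, ∃ a, time a < b := fun b => ⟨(⌊b / time N⌋ - 1) * N, by
    rw [hmul, ← lt_div_iff₀ hT]
    push_cast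
    linarith [Int.floor_le (b / time N)]⟩
  have hidx : ∀ t, ∃ n, time n < t ∧ t ≤ time (n + 1) := by
    intro t
    obtain ⟨a, ha⟩ := htop t
    obtain ⟨n, h1, h2⟩ := exists_last_int (P := fun n => time n < t) (hbot t)
      ⟨a, fun n hn => (hmono.lt_iff_lt.1 (hn.trans_le ha)).le⟩
    exact ⟨n, h1, not_lt.1 h2⟩
  choose idx hidx1 hidx2 using hidx
  have huniq : ∀ {n t}, time n < t → t ≤ time (n + 1) → idx t = n := by
    intro n t h1 h2
    have h3 := hmono.lt_iff_lt.1 ((hidx1 t).trans_le h2)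
    have h4 := hmono.lt_iff_lt.1 (h1.trans_le (hidx2 t))
    omega
  -- The intervals are open on the left and closed on the right: at a hitting time the point is
  -- still on the side it has reached, before the jump.
  set pos : ℝ → ℝ × ℝ := fun t =>
    p (idx t) - (2 : ℝ) • normal (side (idx t)) + (t - time (idx t)) • v with hpos
  have hposn : ∀ n t, time n < t → t ≤ time (n + 1) →
      pos t = p n - (2 : ℝ) • normal (side n) + (t - time n) • v := by
    intro n t h1 h2
    simp only [hpos, huniq h1 h2]
  have hpostime : ∀ n, pos (time n) = p n := by
    intro n
    have h1 := hposn (n - 1) (time n) (hmono (by omega)) (by rw [sub_add_cancel])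
    have h2 := hstep (n - 1)
    have h3 := ht (n - 1)
    rw [sub_add_cancel] at h2 h3
    rw [h1, h2, h3]
    simp
  refine ⟨⟨pos, v, hv, time, side, hmono,
    Filter.tendsto_atTop_atTop_of_monotone hmono.monotone htop,
    Filter.tendsto_atBot_atBot_of_monotone hmono.monotone fun b => (hbot b).imp fun _ h => h.le,
    fun n => by rw [hpostime]; exact hp n, fun n t h1 h2 => ?_, fun n t h1 h2 => ?_⟩,
    ⟨time N, hT, fun t => ?_⟩, rfl⟩
  · rw [hposn n t h1 h2.le]
    have h3 := hp (n + 1)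
    rw [hstep] at h3
    exact segment_mem_interior (hopp n) (hq n) h3 (by linarith) (by rw [ht] at h2; linarith)
  · rw [hposn n t h1 h2, hpostime]
  · have h1 := hidx1 t
    have h2 := hidx2 t
    have h3 : pos (t + time N) = _ := hposn (idx t + N) (t + time N) (by rw [hper]; linarith)
      (by rw [show idx t + N + 1 = idx t + 1 + N by ring, hper]; linarith)
    change pos (t + time N) = pos t
    rw [h3, hposn (idx t) t h1 h2, hpN, hside, hper]
    congr 2
    ring

/-- The side with the given label through which a trajectory in a direction in the sector
`[0, π/8]` leaves the octagon. -/
def exitSide : Letter → Fin 8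
  | .A => 2
  | .B => 1
  | .C => 0
  | .D => 7

/-- With velocity `(l .C, l .A)`, the width of a side is the speed at which its height grows. -/
theorem height_exitSide {l : Letter → ℝ} (hl : IsWidths l) (L : Letter) :
    height (exitSide L) (l .C, l .A) = l L := by
  have h2 := Real.mul_self_sqrt (show (0 : ℝ) ≤ 2 by norm_num)
  have hB := hl.sqrt_mul_B
  have hD := hl.sqrt_mul_D
  cases L <;> simp [height, exitSide, normal_eq]
  · linear_combination (-√2 / 2) * hB + l .B / 2 * h2
  · linear_combination (-√2 / 2) * hD + l .D / 2 * h2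

/-- The transversal coordinate is the cross product with the velocity, constant along the flow, in
units of `√2 - 1`. -/
theorem cross_exitSide {l : Letter → ℝ} (hl : IsWidths l) (L : Letter) :
    l .C * (normal (exitSide L)).2 - l .A * (normal (exitSide L)).1 =
      (√2 - 1) * midpoint l L := by
  have hA := hl.sqrt_mul_A
  have hB := hl.sqrt_mul_B
  have hC := hl.sqrt_mul_C
  have hD := hl.sqrt_mul_D
  cases L <;> simp [exitSide, normal_eq, midpoint] <;> linarith

theorem cross_sidePoint {l : Letter → ℝ} (hl : IsWidths l) {L : Letter} (hL : 0 < l L) (x : ℝ) :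
    l .C * (sidePoint (exitSide L) ((√2 - 1) * (x / l L))).2 -
      l .A * (sidePoint (exitSide L) ((√2 - 1) * (x / l L))).1 =
      (√2 - 1) * (midpoint l L + x) := by
  have h1 := height_exitSide hl L
  have h2 := cross_exitSide hl L
  have h3 : x / l L * l L = x := div_mul_cancel₀ _ hL.ne'
  simp only [height, sidePoint, Prod.fst_add, Prod.snd_add, Prod.smul_fst, Prod.smul_snd,
    smul_eq_mul] at h1 h2 ⊢
  linear_combination h2 + (√2 - 1) * (x / l L) * h1 + (√2 - 1) * h3

theorem PeriodicOrbit.mem_periodicCuttingSequences {u : Word} (h : PeriodicOrbit u) :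
    u ∈ periodicCuttingSequences := by
  obtain ⟨l, hl, f, hf, hc, N, hN, hper⟩ := h
  have hpos : ∀ n, 0 < l (f n).1 := fun n => (abs_nonneg _).trans_lt (hc n).2.1
  have hC := hl.pos
  set side : ℤ → Fin 8 := fun n => exitSide (f n).1 with hsidedef
  set s : ℤ → ℝ := fun n => (√2 - 1) * ((f n).2 / l (f n).1) with hsdef
  have hs : ∀ n, |s n| < √2 - 1 := by
    intro n
    have h1 : 0 < √2 - 1 := sub_pos.2 (Real.lt_sqrt_of_sq_lt (by norm_num))
    rw [hsdef, abs_mul, abs_of_pos h1, abs_div, abs_of_pos (hpos n)]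
    exact mul_lt_of_lt_one_right h1 ((div_lt_one (hpos n)).2 (hc n).2.1)
  set p : ℤ → ℝ × ℝ := fun n => sidePoint (side n) (s n) with hpdef
  -- The flight time read off from the first coordinates. The second coordinates then agree because
  -- the transversal coordinate is preserved, which is the last clause of `Crosses`.
  set d : ℤ → ℝ := fun n => ((p (n + 1)).1 - (p n).1 + 2 * (normal (side n)).1) / l .C with hddef
  have hp : ∀ n, p n ∈ openSide (side n) := fun n => sidePoint_mem_openSide (hs n)
  have hq : ∀ n, p n - (2 : ℝ) • normal (side n) ∈ openSide (side n + 4) := fun n => by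
    simp only [hpdef]
    rw [sidePoint_sub]
    exact sidePoint_mem_openSide (by rw [abs_neg]; exact hs n)
  have hopp : ∀ n, side n + 4 ≠ side (n + 1) := fun n => by
    simp only [hsidedef]
    generalize (f n).1 = L
    generalize (f (n + 1)).1 = L'
    cases L <;> cases L' <;> decide
  have hstep : ∀ n, p (n + 1) = p n - (2 : ℝ) • normal (side n) + d n • (l .C, l .A) := by
    intro n
    have h1 := cross_sidePoint hl (hpos n) (f n).2
    have h2 := cross_sidePoint hl (hpos (n + 1)) (f (n + 1)).2
    have h3 := cross_exitSide hl (f n).1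
    have h4 := (hc n).2.2
    have h5 : d n * l .C = (p (n + 1)).1 - (p n).1 + 2 * (normal (side n)).1 :=
      div_mul_cancel₀ _ hC.ne'
    change l .C * (p n).2 - l .A * (p n).1 = _ at h1
    change l .C * (p (n + 1)).2 - l .A * (p (n + 1)).1 = _ at h2
    change l .C * (normal (side n)).2 - l .A * (normal (side n)).1 = _ at h3
    ext
    · simp only [Prod.fst_add, Prod.fst_sub, Prod.smul_fst, smul_eq_mul]
      linarith
    · simp only [Prod.snd_add, Prod.snd_sub, Prod.smul_snd, smul_eq_mul]
      apply mul_left_cancel₀ hC.ne'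
      linear_combination h2 - h1 + 2 * h3 + (√2 - 1) * h4 - l .A * h5
  have hd : ∀ n, 0 < d n := by
    intro n
    -- The height of the next side is below 1 at the start of the flight and equal to 1 at its end,
    -- and it grows at a positive rate; so the flight time is positive.
    have h1 := (hp (n + 1)).1
    rw [hstep, height_add, height_smul, height_exitSide hl] at h1
    have h2 := (hq n).2 _ (hopp n).symm
    exact pos_of_mul_pos_left (b := l (f (n + 1)).1) (by linarith) (hpos _).le
  have hside : ∀ n, side (n + N) = side n := fun n => by simp only [hsidedef, hper]
  have hpN : ∀ n, p (n + N) = p n := fun n => by simp only [hpdef, hsdef, hside, hper]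
  obtain ⟨τ, hτ, hτs⟩ := exists_periodic_trajectory (v := (l .C, l .A))
    (fun h => hC.ne' (congrArg Prod.fst h)) hd hp hq hopp hstep hN hside hpN fun n => by
      simp only [hddef]
      rw [show n + N + 1 = n + 1 + N by ring, hpN, hpN, hside]
  refine ⟨τ, hτ, funext fun n => ?_⟩
  rw [LinearTrajectory.cuttingSequence, hτs, ← hf n]
  simp only [hsidedef]
  cases (f n).1 <;> rfl

/-! ### Symmetries of the octagon -/

theorem permute_mem_periodicCuttingSequences_of_isometry {g : ℝ × ℝ →ₗ[ℝ] ℝ × ℝ}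
    (hg : Function.Injective g) {σ : Equiv.Perm (Fin 8)} {π : Equiv.Perm Letter}
    (hnormal : ∀ k, normal (σ k) = g (normal k))
    (hheight : ∀ k p, height (σ k) (g p) = height k p)
    (hlabel : ∀ k, sideLabel (σ k) = π (sideLabel k)) {u : Word}
    (hu : u ∈ periodicCuttingSequences) : permute π u ∈ periodicCuttingSequences := by
  obtain ⟨τ, ⟨T, hT, hper⟩, rfl⟩ := hu
  refine ⟨⟨fun t => g (τ.pos t), g τ.vel, fun h => τ.vel_ne_zero (hg (by rw [h, map_zero])),
    τ.time, fun n => σ (τ.side n), τ.time_strictMono, τ.time_tendsto_atTop, τ.time_tendsto_atBot,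
    fun n => ?_, fun n t h1 h2 k => ?_, fun n t h1 h2 => ?_⟩, ⟨T, hT, fun t => ?_⟩,
    funext fun n => hlabel _⟩
  · refine ⟨by rw [hheight]; exact (τ.pos_time n).1, fun k hk => ?_⟩
    obtain ⟨k, rfl⟩ := σ.surjective k
    rw [hheight]
    exact (τ.pos_time n).2 k fun h => hk (by rw [h])
  · obtain ⟨k, rfl⟩ := σ.surjective k
    rw [hheight]
    exact τ.pos_mem_interior n t h1 h2 k
  · rw [τ.pos_eq n t h1 h2, hnormal]
    simp only [map_add, map_sub, map_smul]
  · simp only [hper]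

theorem permute_two_mem {u : Word} (hu : u ∈ periodicCuttingSequences) :
    permute (sectorPerm 2) u ∈ periodicCuttingSequences := by
  have h2 := Real.mul_self_sqrt (show (0 : ℝ) ≤ 2 by norm_num)
  -- Rotation by -π/4, which lowers the number of each side by one modulo 8.
  let g : ℝ × ℝ →ₗ[ℝ] ℝ × ℝ :=
    { toFun := fun p => (√2 / 2 * (p.1 + p.2), √2 / 2 * (p.2 - p.1))
      map_add' := fun p q => by ext <;> simp <;> ring
      map_smul' := fun t p => by ext <;> simp <;> ring }
  have hgp : ∀ p, g p = (√2 / 2 * (p.1 + p.2), √2 / 2 * (p.2 - p.1)) := fun _ => rfl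
  refine permute_mem_periodicCuttingSequences_of_isometry (g := g) (σ := Equiv.addRight 7)
    ?_ ?_ ?_ (by decide) hu
  · refine (injective_iff_map_eq_zero g).2 fun p hp => ?_
    rw [hgp, Prod.mk_eq_zero] at hp
    ext
    · simp only [Prod.fst_zero]
      linear_combination (√2 / 2) * (hp.1 - hp.2) - p.1 / 2 * h2
    · simp only [Prod.snd_zero]
      linear_combination (√2 / 2) * (hp.1 + hp.2) - p.2 / 2 * h2
  · intro k
    rw [hgp]
    fin_cases k <;> ext <;> simp [normal_eq] <;> linarith
  · intro k p
    rw [hgp]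
    have h3 : √2 * √2 * p.1 = 2 * p.1 := by rw [h2]
    have h4 : √2 * √2 * p.2 = 2 * p.2 := by rw [h2]
    fin_cases k <;> simp [height, normal_eq] <;> linarith

theorem permute_seven_mem {u : Word} (hu : u ∈ periodicCuttingSequences) :
    permute (sectorPerm 7) u ∈ periodicCuttingSequences := by
  -- Reflection in the vertical axis, which exchanges the sides `k` and `4 - k`.
  let g : ℝ × ℝ →ₗ[ℝ] ℝ × ℝ :=
    { toFun := fun p => (-p.1, p.2)
      map_add' := fun p q => by ext <;> simp; ring
      map_smul' := fun t p => by ext <;> simp }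
  have hgp : ∀ p, g p = (-p.1, p.2) := fun _ => rfl
  refine permute_mem_periodicCuttingSequences_of_isometry (g := g) (σ := Equiv.subLeft 4)
    ?_ ?_ ?_ (by decide) hu
  · refine (injective_iff_map_eq_zero g).2 fun p hp => ?_
    rw [hgp, Prod.mk_eq_zero] at hp
    ext
    · simpa using hp.1
    · exact hp.2
  · intro k
    rw [hgp]
    fin_cases k <;> ext <;> simp [normal_eq]
  · intro k p
    rw [hgp]
    fin_cases k <;> simp [height, normal_eq]

/-- One rotation and one reflection suffice to undo every relabelling. -/
theorem inv_sectorPerm : ∀ i, ∃ a b : Fin 4,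
    (sectorPerm i)⁻¹ = sectorPerm 2 ^ (a : ℕ) * sectorPerm 7 ^ (b : ℕ) := by
  decide +kernel

theorem permute_pow_mem {π : Equiv.Perm Letter}
    (h : ∀ {u : Word}, u ∈ periodicCuttingSequences → permute π u ∈ periodicCuttingSequences)
    {u : Word} (hu : u ∈ periodicCuttingSequences) (a : ℕ) :
    permute (π ^ a) u ∈ periodicCuttingSequences := by
  induction a with
  | zero => exact hu
  | succ a ih =>
    rw [pow_succ']
    exact h ih

theorem mem_periodicCuttingSequences_of_permute {i : Fin 8} {u : Word}
    (hu : permute (sectorPerm i) u ∈ periodicCuttingSequences) :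
    u ∈ periodicCuttingSequences := by
  obtain ⟨a, b, hab⟩ := inv_sectorPerm i
  have h := permute_pow_mem permute_two_mem (permute_pow_mem permute_seven_mem hu b) a
  convert h using 1
  funext n
  have : u n = (sectorPerm i)⁻¹ (sectorPerm i (u n)) := by simp
  rw [this, hab]
  simp [permute]

theorem LinearTrajectory.realizes_of_isSubword (τ : LinearTrajectory) {u : List Letter}
    (h : IsSubword u τ.cuttingSequence) : τ.Realizes u := by
  obtain ⟨m, hm⟩ := h
  have hmono := τ.time_strictMono
  have h1 := hmono (show m - 1 < m by omega)
  have h2 := hmono (show m + (u.length : ℤ) - 1 < m + u.length by omega)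
  have h3 := hmono.monotone (show m ≤ m + (u.length : ℤ) by omega)
  have h4 := hmono.monotone (show m - 1 ≤ m + (u.length : ℤ) - 1 by omega)
  -- Points at one third and two thirds of the gaps, rather than midpoints, keep `a < b` even when
  -- `u` is empty.
  refine ⟨(2 * τ.time (m - 1) + τ.time m) / 3,
    (τ.time (m + u.length - 1) + 2 * τ.time (m + u.length)) / 3, by linarith, m,
    fun n => ⟨fun ⟨ha, hb⟩ => ⟨?_, ?_⟩, fun ⟨ha, hb⟩ => ⟨?_, ?_⟩⟩, hm⟩
  · by_contra! hn
    have := hmono.monotone (show n ≤ m - 1 by omega)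
    linarith
  · by_contra! hn
    have := hmono.monotone hn
    linarith
  · have := hmono.monotone ha
    linarith
  · have := hmono.monotone (show n ≤ m + u.length - 1 by omega)
    linarith

theorem InfinitelyCoherentWith.exists_eq_on {w : Word} {s : ℕ → Fin 8}
    (h : InfinitelyCoherentWith w s) (m : ℤ) (D : ℕ) :
    ∃ k, ∃ v ∈ generatedPeriodic k s, v ∈ periodicCuttingSequences ∧
      ∀ n, m ≤ n → n ≤ m + D → v n = w n := by
  obtain ⟨-, -, W, ⟨rfl, hder⟩, hcoh⟩ := h
  obtain ⟨k, v, hv, horbit, heq⟩ := exists_generatedPeriodic D s W m hder hcoh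
  exact ⟨k, v, hv,
    mem_periodicCuttingSequences_of_permute horbit.mem_periodicCuttingSequences, heq⟩

theorem InfinitelyCoherentWith.exists_isSubword {w : Word} {s : ℕ → Fin 8}
    (h : InfinitelyCoherentWith w s) {u : List Letter} (hu : IsSubword u w) :
    ∃ k, ∃ v ∈ generatedPeriodic k s, v ∈ periodicCuttingSequences ∧ IsSubword u v := by
  obtain ⟨m, hm⟩ := hu
  obtain ⟨k, v, hv, hcut, heq⟩ := h.exists_eq_on m u.length
  exact ⟨k, v, hv, hcut, m, fun i => by
    rw [heq _ (by omega) (by have := i.2; omega), hm]⟩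

theorem InfinitelyCoherentWith.mem_closure {w : Word} {s : ℕ → Fin 8}
    (h : InfinitelyCoherentWith w s) :
    w ∈ closure ((⋃ k : ℕ, generatedPeriodic k s) ∩ periodicCuttingSequences) := by
  rw [mem_closure_iff]
  intro o ho hw
  -- A basic neighbourhood restricts finitely many coordinates, all contained in one window `[-D,
  -- D]`.
  obtain ⟨I, t, ht, hsub⟩ := isOpen_pi_iff.1 ho w hw
  obtain ⟨D, hD⟩ : ∃ D : ℕ, ∀ n ∈ I, n.natAbs ≤ D :=
    ⟨I.sup Int.natAbs, fun n hn => Finset.le_sup (f := Int.natAbs) hn⟩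
  obtain ⟨k, v, hv, hcut, heq⟩ := h.exists_eq_on (-D) (2 * D)
  refine ⟨v, hsub fun n hn => ?_, Set.mem_iUnion.2 ⟨k, hv⟩, hcut⟩
  have := hD n hn
  rw [heq n (by omega) (by push_cast; omega)]
  exact (ht n hn).2

end Octagon

theorem proposition2p18 (w : Octagon.Word) :
    (Octagon.InfinitelyCoherent w → ∀ u : List Octagon.Letter, Octagon.IsSubword u w →
      ∃ τ : Octagon.LinearTrajectory, τ.IsPeriodic ∧ τ.Realizes u) ∧
    (∀ s : ℕ → Fin 8, Octagon.InfinitelyCoherentWith w s →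
      (∀ u : List Octagon.Letter, Octagon.IsSubword u w →
        ∃ k : ℕ, ∃ v ∈ Octagon.generatedPeriodic k s,
          v ∈ Octagon.periodicCuttingSequences ∧ Octagon.IsSubword u v) ∧
      w ∈ closure ((⋃ k : ℕ, Octagon.generatedPeriodic k s) ∩
        Octagon.periodicCuttingSequences)) := by
  refine ⟨fun ⟨s, hs⟩ u hu => ?_, fun s hs => ⟨fun u hu => hs.exists_isSubword hu,
    hs.mem_closure⟩⟩
  obtain ⟨k, v, -, ⟨τ, hτ, rfl⟩, hv⟩ := hs.exists_isSubword hu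
  exact ⟨τ, hτ, τ.realizes_of_isSubword hv⟩
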